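/- Let $G$ be a group, let $X$ be a set with a right action of $G$, and let $\mu\colon G\to[0,1]$, $\sum_{g\in G}\mu(g)=1$, be a probability measure on $G$ that is symmetric ($\mu(g)=\mu(g^{-1})$ for all $g\in G$) and non-degenerate (its support generates $G$ as a semigroup). Let $p$ be the random walk on $X$ driven by $\mu$: the probability of moving to $x$ from $y$ is $$p(x,y)=\sum_{g\in G,\;x=yg}\mu(g).$$ Call $X$ amenable if there is a $G$-invariant mean on $X$, namely a function $m$ from the subsets of $X$ to $[0,1]$ with $m(X)=1$, $m(A\sqcup B)=m(A)+m(B)$ for all disjoint $A,B\subseteq X$, and $m(Ag)=m(A)$ for all $A\subseteq X$, $g\in G$. Let $$\iota(p)=\inf_{F}\frac{1}{\#F}\sum_{x\in F,\;y\in X\setminus F}p(x,y),$$ the infimum being taken over the finite non-empty subsets $F$ of $X$ (so $\iota(p)=+\infty$ if $X=\emptyset$), and let $\rho(p)$ be the spectral radius of the bounded operator $T$ on $\ell^2(X,\mathbb C)$ given by $(Tf)(x)=\sum_{y\in X}p(x,y)f(y)$ (with $\rho(p)=0$ if $X=\emptyset$). Then the following are equivalent: 1. $X$ is amenable; 2.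 $\iota(p)=0$; 3. $\rho(p)=1$. Moreover, if $X\neq\emptyset$, then $\iota(p)^2+\rho(p)^2\le 1\le\iota(p)+\rho(p)$. -/

import Mathlib

open scoped NNReal ENNReal RightActions

/-- A mean on a set `X`: a finitely additive function `m` on all subsets of `X`, with values in
`[0,1]` and with `m X = 1`. -/
structure Mean (X : Type*) where
  toFun : Set X → ℝ
  mem_Icc : ∀ A, toFun A ∈ Set.Icc (0 : ℝ) 1
  map_univ : toFun Set.univ = 1
  map_union : ∀ A B, Disjoint A B → toFun (A ∪ B) = toFun A + toFun B

/-- A right `G`-set `X` is amenable if it carries a `G`-invariant mean: `m (A g) = m A`. -/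
def IsAmenableSet (G X : Type*) [Group G] [MulAction Gᵐᵒᵖ X] : Prop :=
  ∃ m : Mean X, ∀ (g : G) (A : Set X), m.toFun ((fun x : X => x <• g) '' A) = m.toFun A

/-- A symmetric random walk on `X`, given by its one-step transition probabilities;
`p x y` is the probability of moving to `x` from `y`. -/
structure SymmRandomWalk (X : Type*) where
  p : X → X → ℝ≥0
  hasSum_one : ∀ y, HasSum (fun x => p x y) 1
  symm : ∀ x y, p x y = p y x

namespace SymmRandomWalk

variable {X : Type*} (W : SymmRandomWalk X)

/-- The isoperimetric constant: the infimum, over the finite non-empty `F ⊆ X`, of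
`(∑ x ∈ F, ∑ y ∉ F, p x y) / #F`. It is `∞` when `X` is empty. -/
noncomputable def isoperimetricConstant : ℝ≥0∞ :=
  ⨅ (F : Finset X) (_ : F.Nonempty), (∑ x ∈ F, ∑' y : {y : X // y ∉ F}, (W.p x y : ℝ≥0∞)) / F.card

theorem hasSum_left (x : X) : HasSum (fun y => (W.p x y : ℝ)) 1 := by
  have h := W.hasSum_one x
  simp_rw [fun y => W.symm y x] at h
  have h' := NNReal.hasSum_coe.2 h
  rwa [NNReal.coe_one] at h'

theorem hasSum_right (y : X) : HasSum (fun x => (W.p x y : ℝ)) 1 := by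
  have h := NNReal.hasSum_coe.2 (W.hasSum_one y)
  rwa [NNReal.coe_one] at h

theorem p_le_one (x y : X) : (W.p x y : ℝ) ≤ 1 :=
  le_hasSum (W.hasSum_right y) x (fun _ _ => NNReal.coe_nonneg _)

theorem summable_mul_norm (f : lp (fun _ : X => ℂ) 2) (x : X) :
    Summable fun y => (W.p x y : ℝ) * ‖f y‖ := by
  refine Summable.of_nonneg_of_le (fun y => by positivity) (fun y => ?_)
    ((W.hasSum_left x).summable.mul_right ‖f‖)
  exact mul_le_mul_of_nonneg_left (lp.norm_apply_le_norm (by norm_num) f y) (by positivity)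

theorem summable_mul (f : lp (fun _ : X => ℂ) 2) (x : X) :
    Summable fun y => ((W.p x y : ℝ) : ℂ) * f y := by
  refine Summable.of_norm ?_
  simpa using W.summable_mul_norm f x

theorem summable_sq (f : lp (fun _ : X => ℂ) 2) : Summable fun y => ‖f y‖ ^ 2 := by
  have h := (memℓp_gen_iff (by norm_num)).1 (lp.memℓp f)
  simpa using h

theorem tsum_sq (f : lp (fun _ : X => ℂ) 2) : ∑' y, ‖f y‖ ^ 2 = ‖f‖ ^ 2 := by
  have h := lp.norm_rpow_eq_tsum (p := 2) (by norm_num) f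
  simpa using h.symm

theorem summable_mul_sq (f : lp (fun _ : X => ℂ) 2) (x : X) :
    Summable fun y => (W.p x y : ℝ) * ‖f y‖ ^ 2 := by
  refine Summable.of_nonneg_of_le (fun y => by positivity) (fun y => ?_) (summable_sq f)
  exact mul_le_of_le_one_left (by positivity) (W.p_le_one x y)

theorem norm_tsum_sq_le (f : lp (fun _ : X => ℂ) 2) (x : X) :
    ‖∑' y, ((W.p x y : ℝ) : ℂ) * f y‖ ^ 2 ≤ ∑' y, (W.p x y : ℝ) * ‖f y‖ ^ 2 := by
  have h1 : ‖∑' y, ((W.p x y : ℝ) : ℂ) * f y‖ ≤ ∑' y, (W.p x y : ℝ) * ‖f y‖ := by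
    have := norm_tsum_le_tsum_norm (f := fun y => ((W.p x y : ℝ) : ℂ) * f y)
      (by simpa using W.summable_mul_norm f x)
    simpa using this
  set t := ∑' y, (W.p x y : ℝ) * ‖f y‖ with ht
  have h2 : t ^ 2 ≤ ∑' y, (W.p x y : ℝ) * ‖f y‖ ^ 2 := by
    have hs : HasSum (fun y => (W.p x y : ℝ) * ‖f y‖ ^ 2 - 2 * t * ((W.p x y : ℝ) * ‖f y‖)
        + t ^ 2 * (W.p x y : ℝ)) ((∑' y, (W.p x y : ℝ) * ‖f y‖ ^ 2) - 2 * t * t + t ^ 2 * 1) :=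
      ((W.summable_mul_sq f x).hasSum.sub
        ((W.summable_mul_norm f x).hasSum.mul_left (2 * t))).add
        ((W.hasSum_left x).mul_left (t ^ 2))
    have h0 := hs.nonneg (fun y => by
      have : 0 ≤ (W.p x y : ℝ) * (‖f y‖ - t) ^ 2 := by positivity
      linarith [this])
    linarith
  exact (pow_le_pow_left₀ (norm_nonneg _) h1 2).trans h2

theorem sum_norm_tsum_sq_le (f : lp (fun _ : X => ℂ) 2) (s : Finset X) :
    ∑ x ∈ s, ‖∑' y, ((W.p x y : ℝ) : ℂ) * f y‖ ^ 2 ≤ ‖f‖ ^ 2 := by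
  calc ∑ x ∈ s, ‖∑' y, ((W.p x y : ℝ) : ℂ) * f y‖ ^ 2
      ≤ ∑ x ∈ s, ∑' y, (W.p x y : ℝ) * ‖f y‖ ^ 2 :=
        Finset.sum_le_sum fun x _ => W.norm_tsum_sq_le f x
    _ = ∑' y, ∑ x ∈ s, (W.p x y : ℝ) * ‖f y‖ ^ 2 :=
        (Summable.tsum_finsetSum fun x _ => W.summable_mul_sq f x).symm
    _ ≤ ∑' y, ‖f y‖ ^ 2 := by
        refine Summable.tsum_le_tsum (fun y => ?_)
          (summable_sum fun x _ => W.summable_mul_sq f x) (summable_sq f)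
        rw [← Finset.sum_mul]
        refine mul_le_of_le_one_left (by positivity) ?_
        exact sum_le_hasSum s (fun _ _ => NNReal.coe_nonneg _) (W.hasSum_right y)
    _ = ‖f‖ ^ 2 := tsum_sq f

/-- The transition operator on `ℓ²(X, ℂ)`: `(T f) x = ∑ y, p x y * f y`. -/
noncomputable def transitionOperator :
    lp (fun _ : X => ℂ) 2 →L[ℂ] lp (fun _ : X => ℂ) 2 :=
  LinearMap.mkContinuous
    { toFun := fun f => ⟨fun x => ∑' y, ((W.p x y : ℝ) : ℂ) * f y,
        memℓp_gen' (C := ‖f‖ ^ 2) (by simpa using W.sum_norm_tsum_sq_le f)⟩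
      map_add' := fun f g => by
        ext x
        simp only [lp.coeFn_add, Pi.add_apply, mul_add]
        exact (W.summable_mul f x).tsum_add (W.summable_mul g x)
      map_smul' := fun c f => by
        ext x
        simp only [lp.coeFn_smul, Pi.smul_apply, smul_eq_mul, RingHom.id_apply]
        rw [← tsum_mul_left]
        exact tsum_congr fun y => by ring }
    1 (fun f => by
      rw [one_mul]
      refine lp.norm_le_of_forall_sum_le (by norm_num) (norm_nonneg f) ?_
      simpa using W.sum_norm_tsum_sq_le f)

theorem transitionOperator_apply (f : lp (fun _ : X => ℂ) 2) (x : X) :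
    W.transitionOperator f x = ∑' y, ((W.p x y : ℝ) : ℂ) * f y := rfl

/-- The spectral radius of the random walk: that of its transition operator on `ℓ²(X, ℂ)`. -/
noncomputable def rho : ℝ≥0∞ := spectralRadius ℂ W.transitionOperator

end SymmRandomWalk

/-- The probability measure `μ` on `G` is symmetric. -/
def IsSymmetricMeasure {G : Type*} [Group G] (μ : PMF G) : Prop :=
  ∀ g, μ g = μ g⁻¹

/-- The probability measure `μ` on `G` is non-degenerate: its support generates `G` as a
semigroup. -/
def IsNondegenerateMeasure {G : Type*} [Group G] (μ : PMF G) : Prop :=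
  Subsemigroup.closure μ.support = ⊤

/-- The one-step transition probabilities `p x y = ∑ μ g`, over the `g` with `x = y g`, of the
random walk driven by `μ`. -/
noncomputable def drivenStep {G X : Type*} [Group G] [MulAction Gᵐᵒᵖ X] (μ : PMF G) (x y : X) :
    ℝ≥0 :=
  (∑' g : {g : G // x = y <• g}, μ g).toNNReal

theorem coe_drivenStep {G X : Type*} [Group G] [MulAction Gᵐᵒᵖ X] (μ : PMF G) (x y : X) :
    (drivenStep μ x y : ℝ≥0∞) = ∑' g : {g : G // x = y <• g}, μ g := by
  refine ENNReal.coe_toNNReal (ne_top_of_le_ne_top ENNReal.one_ne_top ?_)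
  rw [← μ.tsum_coe]
  exact ENNReal.tsum_comp_le_tsum_of_injective Subtype.val_injective _

/-- The random walk on the right `G`-set `X` driven by a symmetric probability measure `μ`. -/
noncomputable def drivenWalk {G : Type*} (X : Type*) [Group G] [MulAction Gᵐᵒᵖ X] (μ : PMF G)
    (hμ : IsSymmetricMeasure μ) : SymmRandomWalk X where
  p := drivenStep μ
  hasSum_one y := by
    have h : ∑' x, (drivenStep μ x y : ℝ≥0∞) = 1 := by
      classical
      rw [← (μ.map (fun g => y <• g)).tsum_coe]
      refine tsum_congr fun x => ?_
      rw [coe_drivenStep, PMF.map_apply]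
      rw [show (∑' g : {g : G // x = y <• g}, μ g) = ∑' g : ({g | x = y <• g} : Set G), μ g from rfl,
        tsum_subtype]
      rfl
    have hs : Summable fun x => drivenStep μ x y :=
      ENNReal.tsum_coe_ne_top_iff_summable.1 (by rw [h]; exact ENNReal.one_ne_top)
    have h1 : ∑' x, drivenStep μ x y = 1 := by
      rw [← ENNReal.coe_tsum hs] at h
      exact_mod_cast h
    exact h1 ▸ hs.hasSum
  symm x y := by
    unfold drivenStep
    congr 1
    let e : {g : G // x = y <• g} ≃ {g : G // y = x <• g} :=
      (Equiv.inv G).subtypeEquiv fun g => by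
        simp only [Equiv.inv_apply, MulOpposite.op_inv]
        rw [eq_inv_smul_iff, eq_comm]
    rw [← e.tsum_eq]
    exact tsum_congr fun g => hμ g

/-! Write I for the isoperimetric constant. Each row of `p` sums to 1, so I bounds the weight of `p`
inside any finite F by (1 - I)·#F. The layer-cake inequality extends this bound from indicators of
sets to all finitely supported h ≥ 0 (`sum_mul_min_le`). It is used twice.

For the spectral side, T is self-adjoint, so its spectral radius is its norm, which is the supremum
of its absolute Rayleigh quotients. Testing on indicators of finite sets gives 1 ≤ I + ρ. Applying
the layer-cake inequality to h = f² together with Cauchy–Schwarz (`sq_sum_mul_mul_le`) gives I² + ρ²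
≤ 1. Together these give I = 0 iff ρ = 1.

If I = 0, there are Følner-type sets for the walk. An ultralimit of their densities is a mean that
does not decrease under translation by the support of μ, hence under all of G, hence is invariant.

If I > 0, the layer-cake inequality gives a uniform ℓ¹ gap between finitely supported h ≥ 0 and
their translates by a finite S carrying most of μ. Hahn–Banach converts the gap into bounded
functions u_g with ∑ μ(g)(u_g(x) - u_g(xg)) ≥ c > 0 for every x. An invariant mean would integrate
the left side to 0, so none exists. -/

/-- Layer-cake inequality: if the total weight of `a` inside every finite set `F` is at most
`c * #F`, then `∑ a x y * min (h x) (h y) ≤ c * ∑ h x` for all `h ≥ 0`. -/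
theorem sum_mul_min_le {X : Type*} {a : X → X → ℝ} {c : ℝ}
    (ha : ∀ F : Finset X, ∑ x ∈ F, ∑ y ∈ F, a x y ≤ c * F.card) (F : Finset X) (h : X → ℝ)
    (hh : ∀ x ∈ F, 0 ≤ h x) :
    ∑ x ∈ F, ∑ y ∈ F, a x y * min (h x) (h y) ≤ c * ∑ x ∈ F, h x := by
  classical
  induction F using Finset.strongInduction generalizing h with
  | H F ih =>
    obtain rfl | hF := F.eq_empty_or_nonempty
    · simp
    obtain ⟨x₀, hx₀, hmin⟩ := F.exists_min_image h hF
    set t := h x₀ with ht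
    have hnn : ∀ x ∈ F, 0 ≤ h x - t := fun x hx => sub_nonneg.2 (hmin x hx)
    -- Peel off the bottom layer, of height t = min h. After subtracting t every term involving x₀
    -- vanishes, so the bound on F minus x₀ is a bound on F; the layer itself costs t·∑∑ a ≤ t·c·#F.
    have key := ih (F.erase x₀) (Finset.erase_ssubset hx₀) (fun x => h x - t)
      fun x hx => hnn x (Finset.mem_of_mem_erase hx)
    have e1 : ∑ x ∈ F.erase x₀, ∑ y ∈ F.erase x₀, a x y * min (h x - t) (h y - t)
        = ∑ x ∈ F, ∑ y ∈ F, a x y * min (h x - t) (h y - t) := by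
      rw [← Finset.sum_erase F (a := x₀)]
      · refine Finset.sum_congr rfl fun x hx => Finset.sum_erase F ?_
        rw [← ht, sub_self, min_eq_right (hnn x (Finset.mem_of_mem_erase hx)), mul_zero]
      · refine Finset.sum_eq_zero fun y hy => ?_
        rw [← ht, sub_self, min_eq_left (hnn y hy), mul_zero]
    have e2 : ∑ x ∈ F.erase x₀, (h x - t) = ∑ x ∈ F, (h x - t) :=
      Finset.sum_erase F (by rw [← ht, sub_self])
    rw [e1, e2] at key
    calc ∑ x ∈ F, ∑ y ∈ F, a x y * min (h x) (h y)
        = ∑ x ∈ F, ∑ y ∈ F, a x y * min (h x - t) (h y - t) + t * ∑ x ∈ F, ∑ y ∈ F, a x y := by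
          simp_rw [Finset.mul_sum, ← Finset.sum_add_distrib, min_sub_sub_right]
          exact Finset.sum_congr rfl fun x _ => Finset.sum_congr rfl fun y _ => by ring
      _ ≤ c * ∑ x ∈ F, (h x - t) + t * (c * F.card) :=
          add_le_add key (mul_le_mul_of_nonneg_left (ha F) (hh x₀ hx₀))
      _ = c * ∑ x ∈ F, h x := by
          rw [Finset.sum_sub_distrib, Finset.sum_const, nsmul_eq_mul]; ring

/-! ### Isoperimetry of symmetric random walks and Cheeger's inequality. -/

namespace SymmRandomWalk

variable {X : Type*} (W : SymmRandomWalk X)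

theorem tsum_coe_left (x : X) : ∑' y, (W.p x y : ℝ≥0∞) = 1 := by
  have h := W.hasSum_one x
  simp_rw [fun y => W.symm y x] at h
  rw [← ENNReal.coe_tsum h.summable, h.tsum_eq, ENNReal.coe_one]

theorem sum_boundary_add_sum_inner (F : Finset X) :
    ∑ x ∈ F, ∑' y : {y : X // y ∉ F}, (W.p x y : ℝ≥0∞) + ∑ x ∈ F, ∑ y ∈ F, (W.p x y : ℝ≥0∞)
      = F.card := by
  rw [← Finset.sum_add_distrib]
  have h : ∀ x, ∑' y : {y : X // y ∉ F}, (W.p x y : ℝ≥0∞) + ∑ y ∈ F, (W.p x y : ℝ≥0∞) = 1 := by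
    intro x
    have h1 := Summable.tsum_add_tsum_compl (f := fun y => (W.p x y : ℝ≥0∞)) (s := (F : Set X))
      ENNReal.summable ENNReal.summable
    rw [Finset.tsum_subtype' F fun y => (W.p x y : ℝ≥0∞)] at h1
    rw [add_comm]
    refine Eq.trans (congrArg _ ?_) (h1.trans (W.tsum_coe_left x))
    exact (Equiv.subtypeEquivRight (p := fun y => y ∉ F) (q := fun y => y ∈ (F : Set X)ᶜ)
      fun y => by simp).tsum_eq (fun y : {y // y ∈ (F : Set X)ᶜ} => (W.p x y : ℝ≥0∞))
  simp [h]

theorem sum_boundary_ne_top (F : Finset X) :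
    ∑ x ∈ F, ∑' y : {y : X // y ∉ F}, (W.p x y : ℝ≥0∞) ≠ ∞ :=
  ne_top_of_le_ne_top (ENNReal.natCast_ne_top F.card)
    (le_self_add.trans_eq (W.sum_boundary_add_sum_inner F))

theorem toReal_sum_boundary (F : Finset X) :
    (∑ x ∈ F, ∑' y : {y : X // y ∉ F}, (W.p x y : ℝ≥0∞)).toReal
      = F.card - ∑ x ∈ F, ∑ y ∈ F, (W.p x y : ℝ) := by
  have h := congrArg ENNReal.toReal (W.sum_boundary_add_sum_inner F)
  rw [ENNReal.toReal_add (W.sum_boundary_ne_top F)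
    (by simp [ENNReal.sum_eq_top])] at h
  have h2 : (∑ x ∈ F, ∑ y ∈ F, (W.p x y : ℝ≥0∞)).toReal = ∑ x ∈ F, ∑ y ∈ F, (W.p x y : ℝ) := by
    have : ∑ x ∈ F, ∑ y ∈ F, (W.p x y : ℝ≥0∞) = ((∑ x ∈ F, ∑ y ∈ F, W.p x y : ℝ≥0) : ℝ≥0∞) := by
      push_cast; rfl
    rw [this, ENNReal.coe_toReal]
    push_cast; rfl
  rw [h2, ENNReal.toReal_natCast] at h
  linarith

theorem isoperimetricConstant_le_one [Nonempty X] : W.isoperimetricConstant ≤ 1 := by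
  obtain ⟨x⟩ := ‹Nonempty X›
  refine (iInf₂_le {x} (Finset.singleton_nonempty x)).trans ?_
  refine ENNReal.div_le_of_le_mul ?_
  rw [one_mul]
  exact le_self_add.trans_eq (W.sum_boundary_add_sum_inner {x})

theorem isoperimetricConstant_ne_top [Nonempty X] : W.isoperimetricConstant ≠ ∞ :=
  ne_top_of_le_ne_top ENNReal.one_ne_top W.isoperimetricConstant_le_one

/-- The isoperimetric constant in the form that the layer-cake inequality takes as input: a lower
bound on the boundary is an upper bound on the inner weight. -/
theorem sum_inner_le [Nonempty X] (F : Finset X) :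
    ∑ x ∈ F, ∑ y ∈ F, (W.p x y : ℝ) ≤ (1 - W.isoperimetricConstant.toReal) * F.card := by
  obtain rfl | hF := F.eq_empty_or_nonempty
  · simp
  have h1 : W.isoperimetricConstant * F.card
      ≤ ∑ x ∈ F, ∑' y : {y : X // y ∉ F}, (W.p x y : ℝ≥0∞) := by
    refine (mul_le_mul_left (iInf₂_le F hF) _).trans_eq ?_
    exact ENNReal.div_mul_cancel (by simpa using hF.ne_empty) (ENNReal.natCast_ne_top _)
  have h2 := ENNReal.toReal_mono (W.sum_boundary_ne_top F) h1
  rw [ENNReal.toReal_mul, ENNReal.toReal_natCast, W.toReal_sum_boundary] at h2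
  linarith

theorem sum_row_le_one (F : Finset X) (x : X) : ∑ y ∈ F, (W.p x y : ℝ) ≤ 1 :=
  sum_le_hasSum F (fun _ _ => NNReal.coe_nonneg _) (W.hasSum_left x)

/-- Cheeger's inequality for the quadratic form of the walk. -/
theorem sq_sum_mul_mul_le [Nonempty X] (F : Finset X) (f : X → ℝ) :
    (∑ x ∈ F, ∑ y ∈ F, (W.p x y : ℝ) * (f x * f y)) ^ 2
      ≤ (1 - W.isoperimetricConstant.toReal ^ 2) * (∑ x ∈ F, f x ^ 2) ^ 2 := by
  set I := W.isoperimetricConstant.toReal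
  set N := ∑ x ∈ F, f x ^ 2 with hN
  set τ := ∑ x ∈ F, ∑ y ∈ F, (W.p x y : ℝ) * (f x * f y) with hτ
  set B := ∑ x ∈ F, ∑ y ∈ F, (W.p x y : ℝ) * min (f x ^ 2) (f y ^ 2) with hB
  set R := ∑ x ∈ F, ∑ y ∈ F, (W.p x y : ℝ) * f x ^ 2 with hR
  have hBI : B ≤ (1 - I) * N := sum_mul_min_le W.sum_inner_le F _ fun x _ => sq_nonneg _
  have hRN : R ≤ N := Finset.sum_le_sum fun x _ => by
    rw [← Finset.sum_mul]
    exact mul_le_of_le_one_left (sq_nonneg _) (W.sum_row_le_one F x)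
  have hR' : ∑ x ∈ F, ∑ y ∈ F, (W.p x y : ℝ) * f y ^ 2 = R := by
    rw [Finset.sum_comm]
    exact Finset.sum_congr rfl fun x _ => Finset.sum_congr rfl fun y _ => by rw [W.symm]
  have hN0 : 0 ≤ N := Finset.sum_nonneg fun x _ => sq_nonneg _
  have hI0 : 0 ≤ I := ENNReal.toReal_nonneg
  have hm : ∑ x ∈ F, ∑ y ∈ F, (W.p x y : ℝ) * (f x - f y) ^ 2 = 2 * R - 2 * τ := by
    have : ∀ x y, (W.p x y : ℝ) * (f x - f y) ^ 2 = (W.p x y : ℝ) * f x ^ 2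
        + (W.p x y : ℝ) * f y ^ 2 - 2 * ((W.p x y : ℝ) * (f x * f y)) := fun x y => by ring
    simp_rw [this, Finset.sum_sub_distrib, Finset.sum_add_distrib, ← Finset.mul_sum]
    rw [hR']; ring
  have hp : ∑ x ∈ F, ∑ y ∈ F, (W.p x y : ℝ) * (f x + f y) ^ 2 = 2 * R + 2 * τ := by
    have : ∀ x y, (W.p x y : ℝ) * (f x + f y) ^ 2 = (W.p x y : ℝ) * f x ^ 2
        + (W.p x y : ℝ) * f y ^ 2 + 2 * ((W.p x y : ℝ) * (f x * f y)) := fun x y => by ring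
    simp_rw [this, Finset.sum_add_distrib, ← Finset.mul_sum]
    rw [hR']; ring
  have habs : ∑ x ∈ F, ∑ y ∈ F, (W.p x y : ℝ) * |f x ^ 2 - f y ^ 2| = 2 * R - 2 * B := by
    have : ∀ x y, (W.p x y : ℝ) * |f x ^ 2 - f y ^ 2| = (W.p x y : ℝ) * f x ^ 2
        + (W.p x y : ℝ) * f y ^ 2 - 2 * ((W.p x y : ℝ) * min (f x ^ 2) (f y ^ 2)) := by
      intro x y
      rw [← max_sub_min_eq_abs']
      have := min_add_max (f x ^ 2) (f y ^ 2)
      linear_combination (W.p x y : ℝ) * this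
    simp_rw [this, Finset.sum_sub_distrib, Finset.sum_add_distrib, ← Finset.mul_sum]
    rw [hR']; ring
  -- Cauchy–Schwarz for the weights `p`, with |f(x)² - f(y)²| = |f(x) - f(y)|·|f(x) + f(y)|.
  have hCS : (2 * R - 2 * B) ^ 2 ≤ (2 * R - 2 * τ) * (2 * R + 2 * τ) := by
    rw [← habs, ← hm, ← hp]
    simp_rw [← Finset.sum_product']
    refine Finset.sum_sq_le_sum_mul_sum_of_sq_le_mul _ (fun _ _ => by positivity)
      (fun _ _ => by positivity) fun z _ => ?_
    exact le_of_eq (by rw [mul_pow, sq_abs]; ring)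
  have hP : 0 ≤ 2 * R + 2 * τ := hp ▸ Finset.sum_nonneg fun x _ => Finset.sum_nonneg fun y _ => by
    positivity
  have hM : 0 ≤ 2 * R - 2 * τ := hm ▸ Finset.sum_nonneg fun x _ => Finset.sum_nonneg fun y _ => by
    positivity
  have hRB : R - B ≤ R := by
    have : 0 ≤ B := Finset.sum_nonneg fun x _ => Finset.sum_nonneg fun y _ => by positivity
    linarith
  -- Cauchy–Schwarz reads τ² ≤ R² - (R - B)² = 2RB - B². The mass leaving F makes R smaller than N,
  -- but this expression increases with R since B ≥ 0.
  have h1 : (N - B) ^ 2 ≤ N ^ 2 - τ ^ 2 := by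
    have := mul_nonneg (sub_nonneg.2 hRN) (sub_nonneg.2 hRB)
    nlinarith
  have h2 : (I * N) ^ 2 ≤ (N - B) ^ 2 := pow_le_pow_left₀ (by positivity) (by linarith) 2
  nlinarith

/-! ### The transition operator: norm, spectral radius and the two inequalities. -/

section Operator

open scoped InnerProductSpace

theorem transitionOperator_single [DecidableEq X] (y : X) (b : ℂ) (x : X) :
    W.transitionOperator (lp.single 2 y b) x = ((W.p x y : ℝ) : ℂ) * b := by
  rw [transitionOperator_apply, tsum_eq_single y]
  · rw [lp.single_apply_self]
  · intro z hz
    rw [lp.single_apply_ne _ _ _ hz, mul_zero]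

/-- The matrix of T is real and symmetric, and a bounded operator is determined by its matrix
entries. -/
theorem isSelfAdjoint_transitionOperator : IsSelfAdjoint W.transitionOperator := by
  classical
  rw [ContinuousLinearMap.isSelfAdjoint_iff']
  refine lp.ext_continuousLinearMap (by norm_num) fun y => ContinuousLinearMap.ext fun b => ?_
  refine lp.ext (funext fun x => ?_)
  change (ContinuousLinearMap.adjoint W.transitionOperator) (lp.single 2 y b) x
    = W.transitionOperator (lp.single 2 y b) x
  have h := lp.inner_single_left (𝕜 := ℂ) x (1 : ℂ)
    ((ContinuousLinearMap.adjoint W.transitionOperator) (lp.single 2 y b))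
  rw [ContinuousLinearMap.adjoint_inner_right, lp.inner_single_right,
    W.transitionOperator_single] at h
  rw [W.transitionOperator_single, W.symm x y]
  simp only [RCLike.inner_apply, map_one, mul_one, Complex.conj_ofReal] at h
  rw [← h, mul_comm]

theorem rho_eq_nnnorm : W.rho = ‖W.transitionOperator‖₊ :=
  W.isSelfAdjoint_transitionOperator.spectralRadius_eq_nnnorm

theorem inner_transitionOperator_sum_single [DecidableEq X] (F : Finset X) (f : X → ℂ) :
    ⟪W.transitionOperator (∑ x ∈ F, lp.single 2 x (f x)), ∑ x ∈ F, lp.single 2 x (f x)⟫_ℂ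
      = ∑ x ∈ F, ∑ y ∈ F, (W.p x y : ℂ) * (f x * starRingEnd ℂ (f y)) := by
  rw [map_sum, inner_sum]
  refine Finset.sum_congr rfl fun x _ => ?_
  rw [sum_inner]
  refine Finset.sum_congr rfl fun y _ => ?_
  rw [lp.inner_single_right, W.transitionOperator_single]
  simp only [RCLike.inner_apply, map_mul, Complex.conj_ofReal]
  ring_nf

theorem norm_sq_sum_single [DecidableEq X] (F : Finset X) (f : X → ℂ) :
    ‖∑ x ∈ F, lp.single (E := fun _ : X => ℂ) 2 x (f x)‖ ^ 2 = ∑ x ∈ F, ‖f x‖ ^ 2 := by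
  have h := lp.norm_sum_single (E := fun _ : X => ℂ) (p := 2) (by norm_num) f F
  simpa using h

theorem norm_inner_transitionOperator_le [Nonempty X] (v : lp (fun _ : X => ℂ) 2) :
    ‖⟪W.transitionOperator v, v⟫_ℂ‖
      ≤ √(1 - W.isoperimetricConstant.toReal ^ 2) * ‖v‖ ^ 2 := by
  classical
  set c := √(1 - W.isoperimetricConstant.toReal ^ 2)
  have hlim : Filter.Tendsto (fun F : Finset X => ∑ x ∈ F, lp.single 2 x (v x)) Filter.atTop
      (nhds v) := lp.hasSum_single (by norm_num) v
  -- The inequality is a closed condition on v, so it suffices to check finite truncations, where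
  -- replacing v by |v| reduces it to the real quadratic form.
  have hcl : IsClosed {v : lp (fun _ : X => ℂ) 2 |
      ‖⟪W.transitionOperator v, v⟫_ℂ‖ ≤ c * ‖v‖ ^ 2} :=
    isClosed_le (by fun_prop) (by fun_prop)
  refine hcl.mem_of_tendsto hlim (Filter.Eventually.of_forall fun F => ?_)
  rw [Set.mem_ofPred_eq, inner_transitionOperator_sum_single, norm_sq_sum_single]
  have h1 : ‖∑ x ∈ F, ∑ y ∈ F, (W.p x y : ℂ) * (v x * starRingEnd ℂ (v y))‖
      ≤ ∑ x ∈ F, ∑ y ∈ F, (W.p x y : ℝ) * (‖v x‖ * ‖v y‖) := by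
    refine (norm_sum_le _ _).trans (Finset.sum_le_sum fun x _ => ?_)
    refine (norm_sum_le _ _).trans (Finset.sum_le_sum fun y _ => le_of_eq ?_)
    simp
  refine h1.trans ?_
  have h2 := W.sq_sum_mul_mul_le F fun x => ‖v x‖
  have h3 := Real.le_sqrt_of_sq_le h2
  have hN : 0 ≤ ∑ x ∈ F, ‖v x‖ ^ 2 := by positivity
  have hI : 0 ≤ 1 - W.isoperimetricConstant.toReal ^ 2 := by
    have := ENNReal.toReal_mono ENNReal.one_ne_top W.isoperimetricConstant_le_one
    rw [ENNReal.toReal_one] at this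
    have h0 : 0 ≤ W.isoperimetricConstant.toReal := ENNReal.toReal_nonneg
    nlinarith
  rwa [Real.sqrt_mul hI, Real.sqrt_sq hN] at h3

theorem norm_transitionOperator_le_one : ‖W.transitionOperator‖ ≤ 1 :=
  LinearMap.mkContinuous_norm_le _ zero_le_one _

theorem norm_transitionOperator_le [Nonempty X] :
    ‖W.transitionOperator‖ ≤ √(1 - W.isoperimetricConstant.toReal ^ 2) := by
  rw [ContinuousLinearMap.norm_eq_iSup_rayleighQuotient _
    W.isSelfAdjoint_transitionOperator.isSymmetric]
  refine ciSup_le fun v => ?_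
  rw [ContinuousLinearMap.rayleighQuotient, abs_div, abs_of_nonneg (sq_nonneg ‖v‖)]
  refine div_le_of_le_mul₀ (sq_nonneg _) (Real.sqrt_nonneg _) ?_
  rw [ContinuousLinearMap.reApplyInnerSelf_apply]
  exact (RCLike.abs_re_le_norm _).trans (W.norm_inner_transitionOperator_le v)

theorem isoperimetricConstant_sq_add_rho_sq_le [Nonempty X] :
    W.isoperimetricConstant ^ 2 + W.rho ^ 2 ≤ 1 := by
  have hI : 0 ≤ 1 - W.isoperimetricConstant.toReal ^ 2 := by
    have := ENNReal.toReal_mono ENNReal.one_ne_top W.isoperimetricConstant_le_one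
    rw [ENNReal.toReal_one] at this
    have h0 : 0 ≤ W.isoperimetricConstant.toReal := ENNReal.toReal_nonneg
    nlinarith
  have h : W.isoperimetricConstant.toReal ^ 2 + ‖W.transitionOperator‖ ^ 2 ≤ 1 := by
    have := pow_le_pow_left₀ (norm_nonneg _) W.norm_transitionOperator_le 2
    rw [Real.sq_sqrt hI] at this
    linarith
  have hT : (‖W.transitionOperator‖₊ : ℝ≥0∞) = ENNReal.ofReal ‖W.transitionOperator‖ :=
    (ofReal_norm _).symm
  rw [W.rho_eq_nnnorm, ← ENNReal.ofReal_toReal W.isoperimetricConstant_ne_top, hT,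
    ← ENNReal.ofReal_pow ENNReal.toReal_nonneg,
    ← ENNReal.ofReal_pow (norm_nonneg _), ← ENNReal.ofReal_add (by positivity) (by positivity)]
  exact ENNReal.ofReal_le_one.2 h

/-- The left side is ⟨Tv, v⟩ for v the indicator of F, with ‖v‖² = #F. -/
theorem sum_inner_le_norm_mul (F : Finset X) :
    ∑ x ∈ F, ∑ y ∈ F, (W.p x y : ℝ) ≤ ‖W.transitionOperator‖ * F.card := by
  classical
  have h := W.inner_transitionOperator_sum_single F fun _ => 1
  have hn := norm_sq_sum_single F fun _ => (1 : ℂ)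
  set v : lp (fun _ : X => ℂ) 2 := ∑ x ∈ F, lp.single 2 x (1 : ℂ)
  have h1 : ‖⟪W.transitionOperator v, v⟫_ℂ‖ ≤ ‖W.transitionOperator‖ * ‖v‖ ^ 2 := by
    refine (norm_inner_le_norm _ _).trans ?_
    rw [sq, ← mul_assoc]
    exact mul_le_mul_of_nonneg_right (W.transitionOperator.le_opNorm v) (norm_nonneg v)
  rw [h, hn] at h1
  have h2 : ∑ x ∈ F, ∑ y ∈ F, (W.p x y : ℂ) * (1 * starRingEnd ℂ 1)
      = ((∑ x ∈ F, ∑ y ∈ F, (W.p x y : ℝ) : ℝ) : ℂ) := by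
    push_cast
    simp
  rw [h2, Complex.norm_real] at h1
  refine (le_abs_self _).trans (h1.trans_eq ?_)
  simp

theorem one_le_isoperimetricConstant_add_rho :
    1 ≤ W.isoperimetricConstant + W.rho := by
  rw [← tsub_le_iff_right]
  refine le_iInf₂ fun F hF => ?_
  have hF0 : (F.card : ℝ≥0∞) ≠ 0 := by simpa using hF.ne_empty
  have h := W.sum_inner_le_norm_mul F
  rw [W.rho_eq_nnnorm]
  have h' : ∑ x ∈ F, ∑ y ∈ F, W.p x y ≤ ‖W.transitionOperator‖₊ * F.card := by
    rw [← NNReal.coe_le_coe]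
    push_cast
    exact h
  rw [ENNReal.le_div_iff_mul_le (.inl hF0) (.inl (ENNReal.natCast_ne_top _)),
    ENNReal.sub_mul fun _ _ => ENNReal.natCast_ne_top _, one_mul, tsub_le_iff_right]
  refine (W.sum_boundary_add_sum_inner F).symm.trans_le (add_le_add_right ?_ _)
  exact_mod_cast h'

theorem isoperimetricConstant_eq_zero_iff : W.isoperimetricConstant = 0 ↔ W.rho = 1 := by
  cases isEmpty_or_nonempty X with
  | inl hX =>
    -- On the empty set both sides of the equivalence are false: the constants are ∞ and 0.
    have h1 : W.isoperimetricConstant = ∞ := by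
      simp [isoperimetricConstant, Finset.eq_empty_of_isEmpty]
    have h2 : W.rho = 0 := by
      have : W.transitionOperator = 0 := ContinuousLinearMap.ext fun v =>
        lp.ext (funext fun x => isEmptyElim x)
      rw [W.rho_eq_nnnorm, this, nnnorm_zero, ENNReal.coe_zero]
    simp [h1, h2]
  | inr hX =>
    constructor <;> intro h
    · refine le_antisymm ?_ (by simpa [h] using W.one_le_isoperimetricConstant_add_rho)
      rw [W.rho_eq_nnnorm]
      exact_mod_cast W.norm_transitionOperator_le_one
    · have h' := W.isoperimetricConstant_sq_add_rho_sq_le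
      rw [h, one_pow] at h'
      have h0 : W.isoperimetricConstant ^ 2 + 1 ≤ 0 + 1 := by rwa [zero_add]
      simpa using (ENNReal.add_le_add_iff_right ENNReal.one_ne_top).1 h0

end Operator

end SymmRandomWalk

/-! ### Finitely additive means. -/

namespace Mean

variable {X : Type*} (m : Mean X)

theorem map_empty : m.toFun ∅ = 0 := by
  have h := m.map_union ∅ ∅ (Set.disjoint_empty _)
  rw [Set.union_empty] at h
  linarith

theorem nonempty {X : Type*} (m : Mean X) : Nonempty X := by
  by_contra hX
  rw [not_nonempty_iff] at hX
  have h := m.map_univ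
  rw [Set.univ_eq_empty_iff.2 hX, m.map_empty] at h
  exact zero_ne_one h

theorem map_inter_add_diff (A B : Set X) : m.toFun (B ∩ A) + m.toFun (B \ A) = m.toFun B := by
  rw [← m.map_union _ _ Set.disjoint_sdiff_inter.symm, Set.inter_union_sdiff]

/-- Integrating a lower bound for a simple function against a finitely additive mean, on a
subset. -/
theorem mul_le_sum_inter {ι : Type*} (s : Finset ι) (a : ι → ℝ) (A : ι → Set X) (B : Set X) (c : ℝ)
    (h : ∀ x ∈ B, c ≤ ∑ i ∈ s, a i * (A i).indicator 1 x) :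
    c * m.toFun B ≤ ∑ i ∈ s, a i * m.toFun (B ∩ A i) := by
  classical
  induction s using Finset.induction_on generalizing B c with
  | empty =>
    obtain rfl | ⟨x, hx⟩ := B.eq_empty_or_nonempty
    · simp [m.map_empty]
    · exact mul_nonpos_of_nonpos_of_nonneg (by simpa using h x hx) (m.mem_Icc B).1
  | insert i s hi ih =>
    -- Split B along `A i`: on the part inside, the i-th term is the constant `a i`, which moves
    -- into the lower bound.
    have h1 := ih (B ∩ A i) (c - a i) fun x hx => by
      have := h x hx.1
      rw [Finset.sum_insert hi, Set.indicator_of_mem hx.2, Pi.one_apply] at this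
      linarith
    have h2 := ih (B \ A i) c fun x hx => by
      have := h x hx.1
      rw [Finset.sum_insert hi, Set.indicator_of_notMem hx.2] at this
      linarith
    have h3 : ∑ j ∈ s, a j * m.toFun (B ∩ A j) = ∑ j ∈ s, a j * m.toFun (B ∩ A i ∩ A j)
        + ∑ j ∈ s, a j * m.toFun (B \ A i ∩ A j) := by
      rw [← Finset.sum_add_distrib]
      refine Finset.sum_congr rfl fun j _ => ?_
      rw [← m.map_inter_add_diff (A i) (B ∩ A j), mul_add, Set.inter_right_comm,
        Set.inter_sdiff_right_comm]
    rw [Finset.sum_insert hi, h3]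
    have h4 := m.map_inter_add_diff (A i) B
    rw [← h4]
    linarith

/-- Monotonicity of integration for the simple functions needed below, so that no integral of
bounded functions against m has to be built. -/
theorem le_sum_mul_sub {ι : Type*} (s : Finset ι) (a : ι → ℝ) (A B : ι → Set X) (c : ℝ)
    (h : ∀ x, c ≤ ∑ i ∈ s, a i * ((A i).indicator 1 x - (B i).indicator 1 x)) :
    c ≤ ∑ i ∈ s, a i * (m.toFun (A i) - m.toFun (B i)) := by
  have := m.mul_le_sum_inter (s.disjSum s) (Sum.elim a (-a)) (Sum.elim A B) Set.univ c fun x _ => by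
    refine (h x).trans_eq ?_
    rw [Finset.sum_disjSum, ← Finset.sum_add_distrib]
    refine Finset.sum_congr rfl fun i _ => ?_
    simp only [Sum.elim_inl, Sum.elim_inr, Pi.neg_apply]
    ring
  rw [m.map_univ, mul_one, Finset.sum_disjSum, ← Finset.sum_add_distrib] at this
  refine this.trans_eq (Finset.sum_congr rfl fun i _ => ?_)
  simp only [Sum.elim_inl, Sum.elim_inr, Pi.neg_apply, Set.univ_inter]
  ring

/-- The mean that is the limit along an ultrafilter of the densities in finite non-empty sets. -/
theorem exists_tendsto_density {α : Type*} (U : Ultrafilter α) (F : α → Finset X)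
    (hF : ∀ n, (F n).Nonempty) [∀ A : Set X, DecidablePred (· ∈ A)] :
    ∃ m : Mean X, ∀ A, Filter.Tendsto
      (fun n => (((F n).filter (· ∈ A)).card : ℝ) / (F n).card) U (nhds (m.toFun A)) := by
  classical
  set r : Set X → α → ℝ := fun A n => (((F n).filter (· ∈ A)).card : ℝ) / (F n).card with hr
  have hpos : ∀ n, (0 : ℝ) < (F n).card := fun n => by exact_mod_cast (hF n).card_pos
  have hI : ∀ A n, r A n ∈ Set.Icc (0 : ℝ) 1 := fun A n =>
    ⟨by positivity, (div_le_one (hpos n)).2 (by exact_mod_cast Finset.card_filter_le _ _)⟩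
  have hL : ∀ A, ∃ L ∈ Set.Icc (0 : ℝ) 1, Filter.Tendsto (r A) U (nhds L) := fun A =>
    isCompact_Icc.ultrafilter_le_nhds (U.map (r A))
      (Filter.le_principal_iff.2 (Filter.mem_map.2 (Filter.univ_mem' (hI A))))
  choose L hL1 hL2 using hL
  refine ⟨⟨L, hL1, ?_, fun A B hAB => ?_⟩, hL2⟩
  · refine tendsto_nhds_unique (hL2 Set.univ) (tendsto_const_nhds.congr fun n => ?_)
    simp [hr, (hF n).ne_empty]
  · refine tendsto_nhds_unique (hL2 (A ∪ B)) (((hL2 A).add (hL2 B)).congr fun n => ?_)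
    simp only [hr]
    rw [← add_div, ← Nat.cast_add, ← Finset.card_union_of_disjoint, ← Finset.filter_or]
    · congr
    · exact Finset.disjoint_filter.2 fun x _ hA hB => Set.disjoint_left.1 hAB hA hB

end Mean

/-! ### From vanishing isoperimetric constant to an invariant mean. -/

section Driven

variable {G X : Type*} [Group G] [MulAction Gᵐᵒᵖ X] (μ : PMF G)

theorem sum_filter_le_drivenStep [DecidableEq X] (S : Finset G) (x y : X) :
    ∑ g ∈ S with x = y <• g, (μ g).toReal ≤ drivenStep μ x y := by
  rw [← ENNReal.toReal_sum fun g _ => μ.apply_ne_top g, ← ENNReal.coe_toReal, coe_drivenStep]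
  refine ENNReal.toReal_mono ?_ ?_
  · rw [← coe_drivenStep]; exact ENNReal.coe_ne_top
  · rw [← Finset.tsum_subtype]
    refine ENNReal.tsum_comp_le_tsum_of_injective
      (f := fun g : {g // g ∈ S.filter fun g => x = y <• g} =>
        (⟨g.1, (Finset.mem_filter.1 g.2).2⟩ : {g : G // x = y <• g}))
      (fun a b h => Subtype.ext (congrArg (fun z : {g : G // x = y <• g} => z.1) h))
      fun g : {g : G // x = y <• g} => μ g

theorem le_drivenStep (g : G) (y : X) : (μ g : ℝ≥0∞) ≤ drivenStep μ (y <• g) y := by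
  rw [coe_drivenStep]
  exact ENNReal.le_tsum (⟨g, rfl⟩ : {h : G // y <• g = y <• h})

/-- Each x in F that g moves out of F contributes at least p(x, xg) = p(xg, x) ≥ μ(g) to the
boundary; symmetry is what reverses the step. -/
theorem mul_card_exits_le (hμ : IsSymmetricMeasure μ) [DecidableEq X] (F : Finset X) (g : G) :
    μ g * (F.filter fun x => x <• g ∉ F).card
      ≤ ∑ x ∈ F, ∑' y : {y : X // y ∉ F}, ((drivenWalk X μ hμ).p x y : ℝ≥0∞) := by
  calc μ g * (F.filter fun x => x <• g ∉ F).card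
      = ∑ x ∈ F with x <• g ∉ F, μ g := by rw [Finset.sum_const, nsmul_eq_mul, mul_comm]
    _ ≤ ∑ x ∈ F with x <• g ∉ F, ∑' y : {y : X // y ∉ F}, ((drivenWalk X μ hμ).p x y : ℝ≥0∞) := by
        refine Finset.sum_le_sum fun x hx => ?_
        refine (le_drivenStep μ g x).trans ?_
        change ((drivenWalk X μ hμ).p (x <• g) x : ℝ≥0∞) ≤ _
        rw [(drivenWalk X μ hμ).symm]
        exact ENNReal.le_tsum (⟨x <• g, (Finset.mem_filter.1 hx).2⟩ : {y : X // y ∉ F})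
    _ ≤ _ := Finset.sum_le_sum_of_subset (Finset.filter_subset _ _)

/-- Translation by g injects the points of F ∩ A that stay in F into F ∩ Ag; the remaining points
exit F. -/
theorem card_filter_le_card_filter_image_add [DecidableEq X] [∀ A : Set X, DecidablePred (· ∈ A)]
    (F : Finset X) (A : Set X) (g : G) :
    (F.filter (· ∈ A)).card ≤ (F.filter (· ∈ (fun x : X => x <• g) '' A)).card
      + (F.filter fun x => x <• g ∉ F).card := by
  have h : F.filter (· ∈ A) ⊆ ((F.filter (· ∈ A)).filter fun x => x <• g ∈ F)
      ∪ F.filter fun x => x <• g ∉ F := by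
    intro x hx
    by_cases hg : x <• g ∈ F <;> simp_all
  refine (Finset.card_le_card h).trans ((Finset.card_union_le _ _).trans (Nat.add_le_add_right ?_ _))
  refine Finset.card_le_card_of_injOn (fun x => x <• g) (fun x hx => ?_)
    (MulAction.injective (MulOpposite.op g)).injOn
  simp only [Finset.coe_filter, Finset.mem_filter, Set.mem_ofPred_eq] at hx ⊢
  exact ⟨hx.2, x, hx.1.2, rfl⟩

theorem isAmenableSet_of_isoperimetricConstant_eq_zero (hμ : IsSymmetricMeasure μ)
    (hnd : IsNondegenerateMeasure μ) (h0 : (drivenWalk X μ hμ).isoperimetricConstant = 0) :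
    IsAmenableSet G X := by
  classical
  have hex : ∀ n : ℕ, ∃ F : Finset X, F.Nonempty ∧
      (∑ x ∈ F, ∑' y : {y : X // y ∉ F}, ((drivenWalk X μ hμ).p x y : ℝ≥0∞)) / F.card
        < ((n : ℝ≥0∞) + 1)⁻¹ := by
    intro n
    have h : (drivenWalk X μ hμ).isoperimetricConstant < ((n : ℝ≥0∞) + 1)⁻¹ := by
      rw [h0]
      exact ENNReal.inv_pos.2 (ENNReal.add_ne_top.2 ⟨ENNReal.natCast_ne_top n, ENNReal.one_ne_top⟩)
    obtain ⟨F, hF⟩ := iInf_lt_iff.1 h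
    obtain ⟨hF1, hF2⟩ := iInf_lt_iff.1 hF
    exact ⟨F, hF1, hF2⟩
  choose F hF hFn using hex
  obtain ⟨m, hm⟩ := Mean.exists_tendsto_density (Filter.hyperfilter ℕ) F hF
  have hexit : ∀ g n, (μ g).toReal * ((F n).filter fun x => x <• g ∉ F n).card / (F n).card
      ≤ 1 / ((n : ℝ) + 1) := by
    intro g n
    have h1 := (ENNReal.div_le_div_right (mul_card_exits_le μ hμ (F n) g) _).trans (hFn n).le
    have h2 := ENNReal.toReal_mono (by simp) h1
    simpa [ENNReal.toReal_div, ENNReal.toReal_mul, ENNReal.toReal_inv, ENNReal.toReal_add] using h2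
  have hle : ∀ g ∈ μ.support, ∀ A, m.toFun A ≤ m.toFun ((fun x : X => x <• g) '' A) := by
    intro g hg A
    have hg0 : 0 < (μ g).toReal := ENNReal.toReal_pos ((μ.mem_support_iff g).1 hg) (μ.apply_ne_top g)
    have hlim : Filter.Tendsto (fun n : ℕ => (μ g).toReal⁻¹ * (1 / ((n : ℝ) + 1)))
        (Filter.hyperfilter ℕ) (nhds ((μ g).toReal⁻¹ * 0)) :=
      (tendsto_one_div_add_atTop_nhds_zero_nat.const_mul _).mono_left
        Nat.hyperfilter_le_atTop
    have hsum := (hm ((fun x : X => x <• g) '' A)).add hlim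
    rw [mul_zero, add_zero] at hsum
    refine le_of_tendsto_of_tendsto' (hm A) hsum fun n => ?_
    have hc : (0 : ℝ) < (F n).card := by exact_mod_cast (hF n).card_pos
    have h3 : (((F n).filter fun x => x <• g ∉ F n).card : ℝ) / (F n).card
        ≤ (μ g).toReal⁻¹ * (1 / ((n : ℝ) + 1)) := by
      rw [← div_eq_inv_mul, le_div_iff₀ hg0]
      refine le_trans (le_of_eq ?_) (hexit g n)
      ring
    have h4 : (((F n).filter (· ∈ A)).card : ℝ)
        ≤ ((F n).filter (· ∈ (fun x : X => x <• g) '' A)).card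
          + ((F n).filter fun x => x <• g ∉ F n).card := by
      rw [← Nat.cast_add, Nat.cast_le]
      convert card_filter_le_card_filter_image_add (F n) A g
    have h5 := div_le_div_of_nonneg_right h4 hc.le
    rw [add_div] at h5
    linarith
  -- The inequality is stable under products, so it passes from the support to the semigroup it
  -- generates, which is G. Applied to g⁻¹ it then yields equality.
  have hall : ∀ g : G, ∀ A, m.toFun A ≤ m.toFun ((fun x : X => x <• g) '' A) := by
    intro g
    have hg : g ∈ Subsemigroup.closure μ.support := by rw [hnd]; trivial
    induction hg using Subsemigroup.closure_induction with
    | mem g hg => exact hle g hg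
    | mul a b _ _ ha hb =>
      intro A
      refine (ha A).trans ((hb _).trans_eq ?_)
      rw [Set.image_image]
      simp only [MulOpposite.op_mul, mul_smul]
  refine ⟨m, fun g A => le_antisymm ?_ (hall g A)⟩
  refine (hall g⁻¹ _).trans_eq ?_
  rw [Set.image_image]
  simp

end Driven

/-! ### From an invariant mean to vanishing isoperimetric constant. -/

section Driven

variable {G X : Type*} [Group G] [MulAction Gᵐᵒᵖ X] (μ : PMF G)

/-- The uniform gap in `ℓ¹` between a finitely supported function and its translates. -/
theorem mul_sum_le_sum_mul_abs_sub [Nonempty X] (hμ : IsSymmetricMeasure μ) (S : Finset G)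
    (h : X →₀ ℝ) (hh : ∀ x, 0 ≤ h x) :
    (∑ g ∈ S, (μ g).toReal - (1 - (drivenWalk X μ hμ).isoperimetricConstant.toReal))
        * ∑ x ∈ h.support, h x
      ≤ ∑ g ∈ S, ∑ x ∈ h.support, (μ g).toReal * |h x - h (x <• g⁻¹)| := by
  classical
  set I := (drivenWalk X μ hμ).isoperimetricConstant.toReal
  set F := h.support
  have h1 : ∑ x ∈ F, ∑ y ∈ F, ((drivenWalk X μ hμ).p x y : ℝ) * min (h x) (h y)
      ≤ (1 - I) * ∑ x ∈ F, h x :=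
    sum_mul_min_le (drivenWalk X μ hμ).sum_inner_le F h fun x _ => hh x
  have h2 : ∑ g ∈ S, ∑ x ∈ F, (μ g).toReal * min (h x) (h (x <• g⁻¹))
      ≤ ∑ x ∈ F, ∑ y ∈ F, ((drivenWalk X μ hμ).p x y : ℝ) * min (h x) (h y) := by
    rw [Finset.sum_comm]
    refine Finset.sum_le_sum fun x _ => ?_
    calc ∑ g ∈ S, (μ g).toReal * min (h x) (h (x <• g⁻¹))
        = ∑ g ∈ S, ∑ y ∈ F, if x = y <• g then (μ g).toReal * min (h x) (h y) else 0 := by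
          refine Finset.sum_congr rfl fun g _ => ?_
          have : ∀ y, x = y <• g ↔ x <• g⁻¹ = y := fun y => by
            rw [MulOpposite.op_inv, inv_smul_eq_iff]
          simp_rw [this, Finset.sum_ite_eq]
          -- If xg⁻¹ is outside the support of h, the minimum is 0, so restricting y to the support
          -- loses nothing.
          split_ifs with hx
          · rfl
          · rw [Finsupp.notMem_support_iff.1 hx, min_eq_right (hh x), mul_zero]
      _ = ∑ y ∈ F, (∑ g ∈ S with x = y <• g, (μ g).toReal) * min (h x) (h y) := by
          rw [Finset.sum_comm]
          refine Finset.sum_congr rfl fun y _ => ?_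
          rw [Finset.sum_mul, Finset.sum_filter]
      _ ≤ _ := Finset.sum_le_sum fun y _ =>
          mul_le_mul_of_nonneg_right (sum_filter_le_drivenStep μ S x y) (le_min (hh x) (hh y))
  have h3 : ∑ g ∈ S, ∑ x ∈ F, (μ g).toReal * (h x - min (h x) (h (x <• g⁻¹)))
      ≤ ∑ g ∈ S, ∑ x ∈ F, (μ g).toReal * |h x - h (x <• g⁻¹)| := by
    refine Finset.sum_le_sum fun g _ => Finset.sum_le_sum fun x _ =>
      mul_le_mul_of_nonneg_left ?_ ENNReal.toReal_nonneg
    rcases min_choice (h x) (h (x <• g⁻¹)) with e | e <;> rw [e]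
    · simp
    · exact le_abs_self _
  have h4 : ∑ g ∈ S, ∑ x ∈ F, (μ g).toReal * (h x - min (h x) (h (x <• g⁻¹)))
      = (∑ g ∈ S, (μ g).toReal) * ∑ x ∈ F, h x
        - ∑ g ∈ S, ∑ x ∈ F, (μ g).toReal * min (h x) (h (x <• g⁻¹)) := by
    simp_rw [mul_sub, Finset.sum_sub_distrib, Finset.sum_mul_sum]
  linarith

/-- Duality: a uniform gap in `ℓ¹` is witnessed by bounded functions. -/
theorem exists_bounded_forall_le_sum_mul_sub (S : Finset G) (w : G → ℝ) {δ : ℝ} (hδ : 0 < δ)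
    (hgap : ∀ h : X →₀ ℝ, (∀ x, 0 ≤ h x) → δ * ∑ x ∈ h.support, h x
      ≤ ∑ g ∈ S, ∑ x ∈ h.support, w g * |h x - h (x <• g⁻¹)|) (hw : ∀ g, 0 ≤ w g) :
    ∃ (u : G → X → ℝ) (K c : ℝ), 0 < c ∧ (∀ g x, |u g x| ≤ K) ∧
      ∀ x, c ≤ ∑ g ∈ S, w g * (u g x - u g (x <• g)) := by
  classical
  let e : G → X → lp (fun _ : G × X => ℝ) 1 := fun g x => lp.single 1 (g, x) 1
  let d : X → lp (fun _ : G × X => ℝ) 1 := fun x => ∑ g ∈ S, w g • (e g x - e g (x <• g))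
  -- D sends h to the family of weighted differences between h and its translates; its transpose
  -- sends (u_g) to x ↦ ∑ w(g)(u_g(x) - u_g(xg)).
  let D : (X →₀ ℝ) →ₗ[ℝ] lp (fun _ : G × X => ℝ) 1 := Finsupp.linearCombination ℝ d
  have hD : ∀ (h : X →₀ ℝ), ∀ g ∈ S, ∀ z, D h (g, z) = w g * (h z - h (z <• g⁻¹)) := by
    intro h g hg z
    induction h using Finsupp.induction_linear with
    | zero => simp
    | add f₁ f₂ h₁ h₂ =>
      rw [map_add, lp.coeFn_add, Pi.add_apply, h₁, h₂, Finsupp.add_apply, Finsupp.add_apply]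
      ring
    | single x a =>
      have hx : (x = z <• g⁻¹) ↔ (z = x <• g) := by
        rw [MulOpposite.op_inv, eq_inv_smul_iff, eq_comm]
      simp only [D, d, e, Finsupp.linearCombination_single, lp.coeFn_smul, lp.coeFn_sum,
        Pi.smul_apply, Finset.sum_apply, lp.coeFn_sub, Pi.sub_apply, lp.coeFn_single, smul_eq_mul]
      rw [Finset.sum_eq_single_of_mem g hg]
      · simp only [Pi.single_apply, Prod.mk.injEq, true_and, Finsupp.single_apply, hx,
          eq_comm (a := x) (b := z)]
        split_ifs <;> ring
      · intro g' _ hg'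
        simp [hg'.symm]
  let σ : (X →₀ ℝ) →ₗ[ℝ] ℝ := Finsupp.linearCombination ℝ fun _ => (1 : ℝ)
  have hσ : ∀ h : X →₀ ℝ, σ h = ∑ x ∈ h.support, h x := fun h => by
    simp [σ, Finsupp.linearCombination_apply, Finsupp.sum]
  let P : Set (X →₀ ℝ) := {h | (∀ x, 0 ≤ h x) ∧ σ h = 1}
  have hP : Convex ℝ P := by
    rintro f ⟨hf, hf1⟩ g ⟨hg, hg1⟩ a b ha hb hab
    refine ⟨fun x => ?_, ?_⟩
    · have := hf x
      have := hg x
      simp only [Finsupp.add_apply, Finsupp.smul_apply, smul_eq_mul]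
      positivity
    · rw [map_add, map_smul, map_smul, hf1, hg1, smul_eq_mul, smul_eq_mul, mul_one, mul_one, hab]
  have hnorm : ∀ h ∈ P, δ ≤ ‖D h‖ := by
    rintro h ⟨hh, hh1⟩
    have h1 := hgap h hh
    rw [← hσ, hh1, mul_one] at h1
    refine h1.trans ?_
    have h2 := lp.sum_rpow_le_norm_rpow (p := 1) (by norm_num) (D h) (S ×ˢ h.support)
    simp only [ENNReal.toReal_one, Real.rpow_one] at h2
    rw [Finset.sum_product] at h2
    refine le_trans (le_of_eq ?_) h2
    refine Finset.sum_congr rfl fun g hg => Finset.sum_congr rfl fun x _ => ?_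
    rw [hD h g hg, norm_mul, Real.norm_of_nonneg (hw g), Real.norm_eq_abs]
  -- The gap says that D maps probability vectors outside the open δ-ball. The separating
  -- functional, evaluated on the unit vectors, gives the bounded u; c > 0 because 0 is in the ball,
  -- and point masses give the pointwise bound.
  obtain ⟨f, c, hf1, hf2⟩ := geometric_hahn_banach_open (convex_ball (0 : lp (fun _ : G × X => ℝ) 1) δ)
    Metric.isOpen_ball (hP.linear_image D) (by
      rw [Set.disjoint_left]
      rintro _ hv ⟨h, hh, rfl⟩
      rw [mem_ball_zero_iff] at hv
      exact absurd hv (hnorm h hh).not_gt)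
  refine ⟨fun g x => f (e g x), ‖f‖, c, ?_, fun g x => ?_, fun x => ?_⟩
  · have := hf1 0 (Metric.mem_ball_self hδ)
    rwa [map_zero] at this
  · refine (f.le_opNorm _).trans_eq ?_
    rw [lp.norm_single (by norm_num), norm_one, mul_one]
  · have h1 := hf2 (D (Finsupp.single x 1)) ⟨_, ⟨fun y => ?_, ?_⟩, rfl⟩
    · refine h1.trans_eq ?_
      simp only [D, d, Finsupp.linearCombination_single, one_smul, map_sum, map_smul, map_sub,
        smul_eq_mul]
    · rw [Finsupp.single_apply]; split_ifs <;> norm_num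
    · simp [σ]

/-- An invariant mean annihilates combinations of differences of bounded functions and their
translates. -/
theorem IsAmenableSet.not_forall_le_sum_mul_sub (ham : IsAmenableSet G X) (S : Finset G)
    (w : G → ℝ) (hw : ∀ g, 0 ≤ w g) (hw1 : ∑ g ∈ S, w g ≤ 1) (u : G → X → ℝ) {K c : ℝ} (hc : 0 < c)
    (hu : ∀ g x, |u g x| ≤ K) : ¬ ∀ x, c ≤ ∑ g ∈ S, w g * (u g x - u g (x <• g)) := by
  intro H
  obtain ⟨m, hm⟩ := ham
  set ε := c / 2 with hε
  have hε0 : 0 < ε := half_pos hc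
  -- Since m measures only sets, u + K is rounded down to multiples of ε. The level sets {k > j}, j
  -- < N, have indicators summing to k.
  let k : G → X → ℕ := fun g x => ⌊(u g x + K) / ε⌋₊
  set N := ⌊(K + K) / ε⌋₊ with hN
  have hkN : ∀ g x, k g x ≤ N := fun g x => Nat.floor_le_floor
    (div_le_div_of_nonneg_right (by linarith [(abs_le.1 (hu g x)).2]) hε0.le)
  have hk0 : ∀ g x, 0 ≤ (u g x + K) / ε := fun g x =>
    div_nonneg (by linarith [(abs_le.1 (hu g x)).1]) hε0.le
  have hk1 : ∀ g x, ε * k g x ≤ u g x + K := fun g x => by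
    have := Nat.floor_le (hk0 g x)
    rwa [le_div_iff₀ hε0, mul_comm] at this
  have hk2 : ∀ g x, u g x + K ≤ ε * k g x + ε := fun g x => by
    have := (Nat.lt_floor_add_one ((u g x + K) / ε)).le
    rw [div_le_iff₀ hε0] at this
    linarith
  let A : G × ℕ → Set X := fun i => {x | i.2 < k i.1 x}
  let B : G × ℕ → Set X := fun i => {x | i.2 < k i.1 (x <• i.1)}
  have hcount : ∀ n : ℕ, n ≤ N → ∑ j ∈ Finset.range N, (if j < n then (1 : ℝ) else 0) = n := by
    intro n hn
    rw [← Finset.sum_filter, Finset.sum_const, nsmul_eq_mul, mul_one]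
    congr 1
    rw [show (Finset.range N).filter (· < n) = Finset.range n by
      ext j; simp only [Finset.mem_filter, Finset.mem_range]; omega, Finset.card_range]
  have hAB : ∀ i, m.toFun (A i) = m.toFun (B i) := by
    intro i
    rw [← hm i.1⁻¹ (A i)]
    congr 1
    ext x
    simp only [A, B, Set.mem_image, Set.mem_ofPred_eq]
    constructor
    · rintro ⟨y, hy, rfl⟩
      simpa using hy
    · intro hx
      exact ⟨x <• i.1, hx, by simp⟩
  -- Rounding costs at most ε in total because the weights sum to at most 1. With ε = c/2, dividing
  -- the remaining c - ε by ε gives the lower bound 1.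
  have hmean := m.le_sum_mul_sub (S ×ˢ Finset.range N) (fun i => w i.1) A B 1 fun x => by
    classical
    have h1 : ∑ i ∈ S ×ˢ Finset.range N, w i.1 * ((A i).indicator 1 x - (B i).indicator 1 x)
        = ∑ g ∈ S, w g * ((k g x : ℝ) - k g (x <• g)) := by
      rw [Finset.sum_product]
      refine Finset.sum_congr rfl fun g _ => ?_
      dsimp only
      rw [← Finset.mul_sum, Finset.sum_sub_distrib]
      simp only [Set.indicator_apply, A, B, Set.mem_ofPred_eq, Pi.one_apply]
      rw [hcount _ (hkN g x), hcount _ (hkN g _)]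
    rw [h1]
    have h2 : ∑ g ∈ S, w g * (u g x - u g (x <• g))
        ≤ ∑ g ∈ S, (ε * (w g * ((k g x : ℝ) - k g (x <• g))) + ε * w g) := by
      refine Finset.sum_le_sum fun g _ => ?_
      have : u g x - u g (x <• g) ≤ ε * ((k g x : ℝ) - k g (x <• g)) + ε := by
        linarith [hk2 g x, hk1 g (x <• g)]
      refine (mul_le_mul_of_nonneg_left this (hw g)).trans_eq ?_
      ring
    rw [Finset.sum_add_distrib, ← Finset.mul_sum, ← Finset.mul_sum] at h2
    have h3 := mul_le_mul_of_nonneg_left hw1 hε0.le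
    have h4 := H x
    refine le_of_mul_le_mul_left ?_ hε0
    linarith
  simp only [hAB, sub_self, mul_zero, Finset.sum_const_zero] at hmean
  linarith

theorem IsAmenableSet.isoperimetricConstant_eq_zero (ham : IsAmenableSet G X)
    (hμ : IsSymmetricMeasure μ) : (drivenWalk X μ hμ).isoperimetricConstant = 0 := by
  have : Nonempty X := ham.choose.nonempty
  by_contra h0
  set I := (drivenWalk X μ hμ).isoperimetricConstant.toReal with hI
  have hI0 : 0 < I := ENNReal.toReal_pos h0 (drivenWalk X μ hμ).isoperimetricConstant_ne_top
  have hsum : HasSum (fun g => (μ g).toReal) 1 := by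
    have h := ENNReal.hasSum_toReal (f := fun g => μ g) μ.tsum_coe_ne_top
    rwa [← ENNReal.tsum_toReal_eq μ.apply_ne_top, μ.tsum_coe, ENNReal.toReal_one] at h
  -- With μ(S) > 1 - I/2, the gap constant μ(S) - (1 - I) exceeds I/2.
  obtain ⟨S, hS⟩ := (hsum.eventually (lt_mem_nhds (show 1 - I / 2 < 1 by linarith))).exists
  obtain ⟨u, K, c, hc, hu, H⟩ := exists_bounded_forall_le_sum_mul_sub (X := X) S
    (fun g => (μ g).toReal) (half_pos hI0) (fun h hh => by
      refine le_trans (mul_le_mul_of_nonneg_right ?_ (Finset.sum_nonneg fun x _ => hh x))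
        (mul_sum_le_sum_mul_abs_sub μ hμ S h hh)
      linarith) fun g => ENNReal.toReal_nonneg
  exact ham.not_forall_le_sum_mul_sub S _ (fun g => ENNReal.toReal_nonneg)
    (sum_le_hasSum S (fun g _ => ENNReal.toReal_nonneg) hsum) u hc hu H

end Driven

theorem mainTheorem5 {G X : Type*} [Group G] [MulAction Gᵐᵒᵖ X] (μ : PMF G)
    (hsymm : IsSymmetricMeasure μ) (hnd : IsNondegenerateMeasure μ) :
    (IsAmenableSet G X ↔ (drivenWalk X μ hsymm).isoperimetricConstant = 0) ∧
    (IsAmenableSet G X ↔ (drivenWalk X μ hsymm).rho = 1) ∧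
    (Nonempty X →
      (drivenWalk X μ hsymm).isoperimetricConstant ^ 2 + (drivenWalk X μ hsymm).rho ^ 2 ≤ 1 ∧
      1 ≤ (drivenWalk X μ hsymm).isoperimetricConstant + (drivenWalk X μ hsymm).rho) := by
  have h : IsAmenableSet G X ↔ (drivenWalk X μ hsymm).isoperimetricConstant = 0 :=
    ⟨fun ham => ham.isoperimetricConstant_eq_zero μ hsymm,
      isAmenableSet_of_isoperimetricConstant_eq_zero μ hsymm hnd⟩
  exact ⟨h, h.trans (SymmRandomWalk.isoperimetricConstant_eq_zero_iff _), fun _ =>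
    ⟨SymmRandomWalk.isoperimetricConstant_sq_add_rho_sq_le _,
      SymmRandomWalk.one_le_isoperimetricConstant_add_rho _⟩⟩
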